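/- Let $\mathcal X$ be a finite state space, $P=(P_{ij})$ a transition probability matrix on $\mathcal X$ with rows $P_i$ (the chain induced by a fixed stationary policy), $\sigma_i(p,v)\in\mathbb R$ ($i\in\mathcal X$, $p$ a probability vector on $\mathcal X$, $v\in\mathbb R^{\mathcal X}$) a transition risk mapping (an arbitrary real-valued map of $(p,v)$ for each $i$), $N\ge 1$ a batch size, $\Phi\in\mathbb R^{\mathcal X\times M}$ a feature matrix with rows $\Phi_i$, and $\Theta\subset\mathbb R^M$ a finite set. Write $P^{(N)}(j^{1:N})=\frac1N\sum_{m=1}^N\delta_{j^m}$ for the empirical measure of a batch and $\sigma^{(N)}_i(p,v)=\mathbb E_{j^{1:N}\sim p^N}\big[\sigma_i\big(P^{(N)}(j^{1:N}),v\big)\big]$ for the mini-batch transition risk mapping. There is a constant $R>0$, depending only on these data, such that the following holds for every cost vector $c\in\mathbb R^{\mathcal X}$, every $\alpha\in(0,1)$, every $\lambda>0$, every initial distribution $P_0$ on $\mathcal X$, and every episode simulated as follows. Let $\theta^{\rm prev}$ be a $\Theta$-valued $\mathcal F_0$-measurable parameter vector (the result of the previous iteration; it may be deterministic). The initial state is $s_0\sim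 P_0$. At each time $t\ge 0$, given the past $\mathcal F_t$ up to the moment the state $s_t$ is reached, a batch $j^{1:N}_{t+1}$ of $N$ independent states with distribution $P_{s_t}$ is drawn, and $s_{t+1}$ is a member of this batch selected uniformly at random, independently of the batch and of the past. Put $$\varphi_t=\Phi_{s_t}^\top,\quad c_t=c(s_t),\quad \tilde\sigma_t=\sigma_{s_t}\big(P^{(N)}(j^{1:N}_{t+1}),\Phi\theta^{\rm prev}\big),\quad \sigma_t=\sigma^{(N)}_{s_t}\big(P_{s_t},\Phi\theta^{\rm prev}\big),\quad \Lambda_T=\lambda I+\sum_{t=0}^{T-1}\varphi_t\varphi_t^\top .$$ For $T\ge1$ let $\tilde\theta_T$ be the minimizer over $\theta\in\mathbb R^M$ of $$\frac1T\sum_{t=0}^{T-1}\big[\varphi_t^\top\theta-c_t-\alpha\tilde\sigma_t\big]^2+\rho\|\theta\|^2,$$ and let $\hat\theta_T$ be the minimizer of the same function with $\sigma_t$ in place of $\tilde\sigma_t$, where the regularization weight is either $\rho=\lambda/T$ or $\rho=\lambda$. These minimizers exist and are unique: for every $\kappa>0$ the unique minimizers for $\rho=\kappa/T$ are $\big(\kappa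 I+\sum_{t<T}\varphi_t\varphi_t^\top\big)^{-1}\sum_{t<T}\varphi_t[c_t+\alpha\tilde\sigma_t]$ and $\big(\kappa I+\sum_{t<T}\varphi_t\varphi_t^\top\big)^{-1}\sum_{t<T}\varphi_t[c_t+\alpha\sigma_t]$, respectively; in particular $\tilde\theta_T=\Lambda_T^{-1}\sum_{t<T}\varphi_t[c_t+\alpha\tilde\sigma_t]$ and $\hat\theta_T=\Lambda_T^{-1}\sum_{t<T}\varphi_t[c_t+\alpha\sigma_t]$ when $\rho=\lambda/T$. For every $\delta>0$, with probability at least $1-\delta$, for all $T\ge1$ and for both choices of $\rho$, $$\big\langle\tilde\theta_T-\hat\theta_T,\ \Lambda_T(\tilde\theta_T-\hat\theta_T)\big\rangle\le 2\alpha^2R^2\ln\!\left(\frac{(\det\Lambda_T)^{1/2}}{\delta\,\lambda^{M/2}}\right).$$ -/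

import Mathlib

open MeasureTheory
open scoped Matrix

/-- The empirical measure `(1/N) ∑ₘ δ_{y m}` of a batch `y` of `N ≥ 1` states, as a point of
the probability simplex over the finite state space `X`. -/
noncomputable def empiricalMeasure {X : Type*} [Fintype X] [DecidableEq X] {N : ℕ} [NeZero N]
    (y : Fin N → X) : stdSimplex ℝ X :=
  ⟨fun x => (1 / (N : ℝ)) * ∑ m, if y m = x then 1 else 0, by
    constructor
    · intro x
      exact mul_nonneg (by positivity)
        (Finset.sum_nonneg fun m _ => by split_ifs <;> norm_num)
    · rw [← Finset.mul_sum, Finset.sum_comm]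
      have hN : (N : ℝ) ≠ 0 := by exact_mod_cast NeZero.ne N
      simp [hN]⟩

/-- The mini-batch transition risk mapping
`σᵢ^(N)(p, v) = E_{y ∼ p^N} [σᵢ(empirical measure of y, v)]`
derived from the base transition risk mapping `σ`. The expectation over the finite product space
`X^N` is written as a sum. -/
noncomputable def miniBatchRisk {X : Type*} [Fintype X] [DecidableEq X] (N : ℕ) [NeZero N]
    (σ : X → stdSimplex ℝ X → (X → ℝ) → ℝ) (i : X) (p : stdSimplex ℝ X) (v : X → ℝ) : ℝ :=
  ∑ y : Fin N → X, (∏ m, p.1 (y m)) * σ i (empiricalMeasure y) v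

/-- A simulated episode of the Markov chain with initial distribution `P₀` and transition
probabilities `P`, relative to a filtration `ℱ`. At time `t` the chain is in state `s t`; a batch
`j (t + 1)` of `N` successor states, independent with distribution `P (s t)` given the past `ℱ t`,
is drawn together with an index `k (t + 1)`, uniform on the batch and independent of the batch and
of the past; the selected member of the batch is the next state. -/
structure IsEpisode {X Ω : Type*} [Fintype X] [MeasurableSpace X] {mΩ : MeasurableSpace Ω}
    {N : ℕ} (P₀ : stdSimplex ℝ X) (P : X → stdSimplex ℝ X) (μ : Measure Ω)
    (ℱ : Filtration ℕ mΩ) (s : ℕ → Ω → X) (j : ℕ → Ω → Fin N → X) (k : ℕ → Ω → Fin N) :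
    Prop where
  measurable_state : ∀ t, Measurable[ℱ t] (s t)
  measurable_batch : ∀ t, Measurable[ℱ (t + 1)] (j (t + 1))
  measurable_index : ∀ t, Measurable[ℱ (t + 1)] (k (t + 1))
  initial : ∀ x, μ.real {ω | s 0 ω = x} = P₀.1 x
  conditional_law : ∀ (t : ℕ) (y : Fin N → X) (n : Fin N),
    μ[{ω | j (t + 1) ω = y ∧ k (t + 1) ω = n}.indicator (fun _ => (1 : ℝ)) | ℱ t] =ᵐ[μ]
      fun ω => (∏ m, (P (s t ω)).1 (y m)) * (1 / (N : ℝ))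
  next_state : ∀ t ω, s (t + 1) ω = j (t + 1) ω (k (t + 1) ω)

/-- The matrix `Λ_T = lam I + ∑_{t<T} φ_t φ_tᵀ`. -/
noncomputable def regGram {M : ℕ} (lam : ℝ) (φ : ℕ → Fin M → ℝ) (T : ℕ) :
    Matrix (Fin M) (Fin M) ℝ :=
  lam • (1 : Matrix (Fin M) (Fin M) ℝ) + ∑ t ∈ Finset.range T, Matrix.vecMulVec (φ t) (φ t)

/-- The regularized least-squares objective
`(1/T) ∑_{t<T} (⟨φ_t, θ⟩ - y_t)² + ρ ‖θ‖²` (Euclidean norm). -/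
noncomputable def regLoss {M : ℕ} (ρ : ℝ) (φ : ℕ → Fin M → ℝ) (y : ℕ → ℝ) (T : ℕ)
    (θ : Fin M → ℝ) : ℝ :=
  (1 / (T : ℝ)) * ∑ t ∈ Finset.range T, (φ t ⬝ᵥ θ - y t) ^ 2 + ρ * (θ ⬝ᵥ θ)

/-- `θ` minimizes the regularized least-squares objective. -/
def IsRegSolution {M : ℕ} (ρ : ℝ) (φ : ℕ → Fin M → ℝ) (y : ℕ → ℝ) (T : ℕ)
    (θ : Fin M → ℝ) : Prop :=
  ∀ θ', regLoss ρ φ y T θ ≤ regLoss ρ φ y T θ'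

/-- The feature vectors `φ_t = (Φ_{s_t})ᵀ` of the visited states. -/
def featurePath {X Ω : Type*} {M : ℕ} (Φ : Matrix X (Fin M) ℝ) (s : ℕ → Ω → X) (ω : Ω) (t : ℕ) :
    Fin M → ℝ :=
  Φ (s t ω)

/-- The sample targets `c(s_t) + α σ̃_t`, where
`σ̃_t = σ_{s_t}(empirical measure of the batch drawn at s_t, v)`. -/
noncomputable def sampleTarget {X Ω : Type*} [Fintype X] [DecidableEq X] {N : ℕ} [NeZero N]
    (σ : X → stdSimplex ℝ X → (X → ℝ) → ℝ) (c : X → ℝ) (α : ℝ)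
    (s : ℕ → Ω → X) (j : ℕ → Ω → Fin N → X) (v : X → ℝ) (ω : Ω) (t : ℕ) : ℝ :=
  c (s t ω) + α * σ (s t ω) (empiricalMeasure (j (t + 1) ω)) v

/-- The ideal targets `c(s_t) + α σ_t`, where `σ_t = σ_{s_t}^(N)(P_{s_t}, v)`. -/
noncomputable def idealTarget {X Ω : Type*} [Fintype X] [DecidableEq X] (N : ℕ) [NeZero N]
    (σ : X → stdSimplex ℝ X → (X → ℝ) → ℝ) (P : X → stdSimplex ℝ X) (c : X → ℝ) (α : ℝ)
    (s : ℕ → Ω → X) (v : X → ℝ) (ω : Ω) (t : ℕ) : ℝ :=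
  c (s t ω) + α * miniBatchRisk N σ (s t ω) (P (s t ω)) v

/-! ### Ridge regression: normal equations and comparison of weights. -/

section LeastSquares

variable {M : ℕ}

/-! The two targets differ by `α` times the noise `σ̃_t - σ_t`; the costs cancel. By the definition
of the mini-batch mapping this noise has conditional mean zero given `ℱ t`, and it is bounded by
some `R` because states, batches and `Θ` are finite. Divided by `R` it is conditionally
1-subgaussian, by Hoeffding's lemma (`sum_mul_exp_miniBatch_noise_le`). Let `S` be the sum of the
normalized noises times `φ_t`. For `ρ = lam / T` the left side equals `α² R² ⟨S, Λ⁻¹ S⟩`; the weight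
`ρ = lam` only shrinks it (`dotProduct_regGram_mulVec_le`).

The form `⟨S, Λ⁻¹ S⟩` is controlled for all `T` at once by the method of mixtures. For fixed `x`,
`exp (⟨x, S⟩ - ∑ ⟨φ_t, x⟩² / 2)` is a supermartingale in `T`; averaging over `x ∼ N(0, lam⁻¹ I)`
gives `mixtureValue`. The `M`-dimensional integral is never formed: starting from its closed form,
the determinant lemma and Sherman–Morrison reduce one time step to a scalar Gaussian average
(`sum_mul_exp_quadratic_le_sqrt`). Ville's inequality then keeps the mixture below `1 / δ` off an
event of probability at most `δ`, and a logarithm gives the bound. -/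

theorem regGram_posDef {lam : ℝ} (hlam : 0 < lam) (φ : ℕ → Fin M → ℝ) (T : ℕ) :
    (regGram lam φ T).PosDef := by
  refine (Matrix.PosDef.one.smul hlam).add_posSemidef (Matrix.posSemidef_sum _ fun t _ => ?_)
  simpa using Matrix.posSemidef_vecMulVec_self_star (φ t)

theorem regGram_zero (lam : ℝ) (φ : ℕ → Fin M → ℝ) :
    regGram lam φ 0 = lam • (1 : Matrix (Fin M) (Fin M) ℝ) := by
  simp [regGram]

theorem regGram_succ (lam : ℝ) (φ : ℕ → Fin M → ℝ) (T : ℕ) :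
    regGram lam φ (T + 1) = regGram lam φ T + Matrix.vecMulVec (φ T) (φ T) := by
  simp [regGram, Finset.sum_range_succ, add_assoc]

theorem regGram_eq_add (lam κ : ℝ) (φ : ℕ → Fin M → ℝ) (T : ℕ) :
    regGram κ φ T = regGram lam φ T + (κ - lam) • (1 : Matrix (Fin M) (Fin M) ℝ) := by
  simp only [regGram, sub_smul]
  abel

theorem Matrix.PosDef.dotProduct_mulVec_comm {A : Matrix (Fin M) (Fin M) ℝ} (hA : A.PosDef)
    (x y : Fin M → ℝ) : x ⬝ᵥ A *ᵥ y = y ⬝ᵥ A *ᵥ x := by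
  have h : Aᵀ = A := by simpa using hA.isHermitian.eq
  rw [Matrix.dotProduct_mulVec, ← Matrix.mulVec_transpose, h, dotProduct_comm]

theorem Matrix.PosDef.dotProduct_mulVec_self_nonneg {A : Matrix (Fin M) (Fin M) ℝ}
    (hA : A.PosDef) (x : Fin M → ℝ) : 0 ≤ x ⬝ᵥ A *ᵥ x := by
  simpa using hA.posSemidef.dotProduct_mulVec_nonneg x

theorem Matrix.PosDef.mulVec_inv_mulVec {A : Matrix (Fin M) (Fin M) ℝ} (hA : A.PosDef)
    (b : Fin M → ℝ) : A *ᵥ (A⁻¹ *ᵥ b) = b := by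
  rw [Matrix.mulVec_mulVec, Matrix.mul_nonsing_inv _ hA.det_pos.ne'.isUnit, Matrix.one_mulVec]

theorem Matrix.PosDef.inv_mulVec_eq_of_mulVec_eq {A : Matrix (Fin M) (Fin M) ℝ} (hA : A.PosDef)
    {x b : Fin M → ℝ} (h : A *ᵥ x = b) : A⁻¹ *ᵥ b = x := by
  rw [← h, Matrix.mulVec_mulVec, Matrix.nonsing_inv_mul _ hA.det_pos.ne'.isUnit,
    Matrix.one_mulVec]

theorem dotProduct_regGram_mulVec (κ : ℝ) (φ : ℕ → Fin M → ℝ) (T : ℕ) (x y : Fin M → ℝ) :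
    x ⬝ᵥ regGram κ φ T *ᵥ y =
      κ * (x ⬝ᵥ y) + ∑ t ∈ Finset.range T, (φ t ⬝ᵥ x) * (φ t ⬝ᵥ y) := by
  simp only [regGram, Matrix.add_mulVec, Matrix.sum_mulVec, Matrix.smul_mulVec,
    Matrix.one_mulVec, dotProduct_add, dotProduct_smul, dotProduct_sum, smul_eq_mul,
    Matrix.vecMulVec_mulVec, op_smul_eq_smul]
  congr 1
  refine Finset.sum_congr rfl fun t _ => ?_
  rw [dotProduct_comm x, mul_comm]

/-- The loss is quadratic, so it equals its second-order expansion, and the normal equations `hθ`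
kill the linear term. -/
theorem regLoss_eq_add {κ : ℝ} {T : ℕ} (hT : 1 ≤ T) (φ : ℕ → Fin M → ℝ) (y : ℕ → ℝ)
    {θ : Fin M → ℝ} (hθ : regGram κ φ T *ᵥ θ = ∑ t ∈ Finset.range T, y t • φ t)
    (θ' : Fin M → ℝ) :
    regLoss (κ / T) φ y T θ' =
      regLoss (κ / T) φ y T θ + (1 / (T : ℝ)) * ((θ' - θ) ⬝ᵥ regGram κ φ T *ᵥ (θ' - θ)) := by
  have hT' : (T : ℝ) ≠ 0 := by positivity
  obtain ⟨d, rfl⟩ : ∃ d, θ' = θ + d := ⟨θ' - θ, by abel⟩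
  have h1 : d ⬝ᵥ regGram κ φ T *ᵥ θ = ∑ t ∈ Finset.range T, y t * (φ t ⬝ᵥ d) := by
    rw [hθ, dotProduct_sum]
    exact Finset.sum_congr rfl fun t _ => by rw [dotProduct_smul, dotProduct_comm, smul_eq_mul]
  rw [dotProduct_regGram_mulVec] at h1
  rw [add_sub_cancel_left, dotProduct_regGram_mulVec]
  simp only [regLoss, dotProduct_add, add_dotProduct]
  have h2 : ∑ t ∈ Finset.range T, (φ t ⬝ᵥ θ + φ t ⬝ᵥ d - y t) ^ 2 =
      ∑ t ∈ Finset.range T, (φ t ⬝ᵥ θ - y t) ^ 2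
      + 2 * ∑ t ∈ Finset.range T, (φ t ⬝ᵥ d) * (φ t ⬝ᵥ θ)
      - 2 * ∑ t ∈ Finset.range T, y t * (φ t ⬝ᵥ d)
      + ∑ t ∈ Finset.range T, (φ t ⬝ᵥ d) * (φ t ⬝ᵥ d) := by
    simp only [Finset.mul_sum, ← Finset.sum_add_distrib, ← Finset.sum_sub_distrib]
    exact Finset.sum_congr rfl fun t _ => by ring
  rw [h2, ← h1, dotProduct_comm θ d]
  field_simp
  ring

/-- The regularized least-squares problem with weight `κ / T` has the unique solution
`(κ I + ∑ φ_t φ_tᵀ)⁻¹ ∑ y_t φ_t`. -/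
theorem isRegSolution_iff {κ : ℝ} (hκ : 0 < κ) {T : ℕ} (hT : 1 ≤ T) (φ : ℕ → Fin M → ℝ)
    (y : ℕ → ℝ) (θ : Fin M → ℝ) :
    IsRegSolution (κ / T) φ y T θ ↔
      θ = (regGram κ φ T)⁻¹ *ᵥ ∑ t ∈ Finset.range T, y t • φ t := by
  have hG := regGram_posDef hκ φ T
  have hT' : 0 < 1 / (T : ℝ) := by positivity
  have key := regLoss_eq_add hT φ y (hG.mulVec_inv_mulVec (∑ t ∈ Finset.range T, y t • φ t))
  set θ₀ := (regGram κ φ T)⁻¹ *ᵥ ∑ t ∈ Finset.range T, y t • φ t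
  constructor
  · intro h
    by_contra hne
    have hpos := hG.dotProduct_mulVec_pos (sub_ne_zero.mpr hne)
    rw [star_trivial] at hpos
    have := h θ₀
    rw [key θ] at this
    linarith [mul_pos hT' hpos]
  · rintro rfl θ'
    rw [key θ']
    linarith [mul_nonneg hT'.le (hG.dotProduct_mulVec_self_nonneg (θ' - θ₀))]

/-- More regularization shrinks the solution in the `Λ`-norm. With `d` and `x` the solutions for `κ`
and `lam`, `⟨d, x⟩_Λ ≥ ‖d‖_Λ²`, so `0 ≤ ‖x - d‖_Λ² ≤ ‖x‖_Λ² - ‖d‖_Λ²`. -/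
theorem dotProduct_regGram_mulVec_le {lam κ : ℝ} (hlam : 0 < lam) (hκ : lam ≤ κ)
    (φ : ℕ → Fin M → ℝ) (T : ℕ) (b : Fin M → ℝ) :
    ((regGram κ φ T)⁻¹ *ᵥ b) ⬝ᵥ regGram lam φ T *ᵥ ((regGram κ φ T)⁻¹ *ᵥ b) ≤
      b ⬝ᵥ (regGram lam φ T)⁻¹ *ᵥ b := by
  have hA := regGram_posDef hlam φ T
  have hd := (regGram_posDef (hlam.trans_le hκ) φ T).mulVec_inv_mulVec b
  have hx := hA.mulVec_inv_mulVec b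
  set d := (regGram κ φ T)⁻¹ *ᵥ b
  set x := (regGram lam φ T)⁻¹ *ᵥ b
  rw [regGram_eq_add lam κ] at hd
  set A := regGram lam φ T
  have h0 := hA.dotProduct_mulVec_self_nonneg (x - d)
  have h1 : b ⬝ᵥ x = x ⬝ᵥ A *ᵥ x := by rw [hx, dotProduct_comm]
  have h2 : d ⬝ᵥ A *ᵥ x = d ⬝ᵥ A *ᵥ d + (κ - lam) * (d ⬝ᵥ d) := by
    rw [hx, ← hd]
    simp [Matrix.add_mulVec, Matrix.smul_mulVec]
  have h3 := hA.dotProduct_mulVec_comm x d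
  have h4 : 0 ≤ (κ - lam) * (d ⬝ᵥ d) :=
    mul_nonneg (sub_nonneg.mpr hκ) (Finset.sum_nonneg fun i _ => mul_self_nonneg (d i))
  rw [Matrix.mulVec_sub, dotProduct_sub, sub_dotProduct, sub_dotProduct] at h0
  linarith

end LeastSquares

/-! ### Determinant and inverse under a rank-one update. -/

section RankOneUpdate

variable {M : ℕ} {A : Matrix (Fin M) (Fin M) ℝ}

theorem Matrix.PosDef.add_vecMulVec_self (hA : A.PosDef) (φ : Fin M → ℝ) :
    (A + Matrix.vecMulVec φ φ).PosDef :=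
  hA.add_posSemidef (by simpa using Matrix.posSemidef_vecMulVec_self_star φ)

theorem Matrix.PosDef.det_add_vecMulVec_self (hA : A.PosDef) (φ : Fin M → ℝ) :
    (A + Matrix.vecMulVec φ φ).det = A.det * (1 + φ ⬝ᵥ A⁻¹ *ᵥ φ) := by
  rw [Matrix.vecMulVec_eq Unit, Matrix.det_add_replicateCol_mul_replicateRow hA.det_pos.ne'.isUnit]
  congr 1
  rw [Matrix.det_unique, Matrix.add_apply, Matrix.one_apply_eq, Matrix.mul_assoc]
  rfl

theorem Matrix.PosDef.inv_add_vecMulVec_self_quadratic (hA : A.PosDef) (φ b : Fin M → ℝ)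
    (ε : ℝ) :
    (b + ε • φ) ⬝ᵥ (A + Matrix.vecMulVec φ φ)⁻¹ *ᵥ (b + ε • φ) =
      b ⬝ᵥ A⁻¹ *ᵥ b +
        (2 * (φ ⬝ᵥ A⁻¹ *ᵥ b) * ε + (φ ⬝ᵥ A⁻¹ *ᵥ φ) * ε ^ 2 - (φ ⬝ᵥ A⁻¹ *ᵥ b) ^ 2) /
          (1 + φ ⬝ᵥ A⁻¹ *ᵥ φ) := by
  have hb := hA.mulVec_inv_mulVec b
  have hφ := hA.mulVec_inv_mulVec φ
  have hw : 0 ≤ φ ⬝ᵥ A⁻¹ *ᵥ φ := hA.inv.dotProduct_mulVec_self_nonneg φ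
  have hc : b ⬝ᵥ A⁻¹ *ᵥ φ = φ ⬝ᵥ A⁻¹ *ᵥ b := hA.inv.dotProduct_mulVec_comm b φ
  -- Sherman–Morrison, checked by multiplying the candidate solution out.
  have hsolve : (A + Matrix.vecMulVec φ φ) *ᵥ
      (A⁻¹ *ᵥ b + ((ε - φ ⬝ᵥ A⁻¹ *ᵥ b) / (1 + φ ⬝ᵥ A⁻¹ *ᵥ φ)) • A⁻¹ *ᵥ φ) = b + ε • φ := by
    rw [Matrix.add_mulVec, Matrix.mulVec_add, Matrix.mulVec_smul, hb, hφ,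
      Matrix.vecMulVec_mulVec, op_smul_eq_smul, dotProduct_add, dotProduct_smul, smul_eq_mul,
      add_assoc, ← add_smul]
    congr 2
    field_simp
    ring
  rw [(hA.add_vecMulVec_self φ).inv_mulVec_eq_of_mulVec_eq hsolve]
  simp only [dotProduct_add, add_dotProduct, dotProduct_smul, smul_dotProduct, smul_eq_mul, hc]
  field_simp
  ring

end RankOneUpdate

/-! ### Subgaussian noise and the Gaussian mixture. -/

section GaussianMixture

theorem integrable_exp_neg_mul_sub_sq {b : ℝ} (hb : 0 < b) (c : ℝ) :
    Integrable fun z : ℝ => Real.exp (-b * (z - c) ^ 2) :=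
  (integrable_exp_neg_mul_sq hb).comp_sub_right c

theorem integral_exp_neg_mul_sub_sq (b c : ℝ) :
    ∫ z : ℝ, Real.exp (-b * (z - c) ^ 2) = √(Real.pi / b) := by
  rw [← integral_gaussian b]
  exact integral_sub_right_eq_self (fun z : ℝ => Real.exp (-b * z ^ 2)) c

/-- A finitely supported `1`-subgaussian random variable has a bounded exponential quadratic
moment: mix the bounds `E exp (z ε - z² / 2) ≤ 1` over `z ∼ N(a, w)`. -/
theorem sum_mul_exp_quadratic_le_sqrt {ι : Type*} [Fintype ι] (p h : ι → ℝ)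
    (hsub : ∀ z : ℝ, ∑ y, p y * Real.exp (z * h y) ≤ Real.exp (z ^ 2 / 2))
    (a : ℝ) {w : ℝ} (hw : 0 ≤ w) :
    ∑ y, p y * Real.exp ((2 * a * h y + w * h y ^ 2 - a ^ 2) / (2 * (1 + w))) ≤ √(1 + w) := by
  have hsub' : ∀ z : ℝ, ∑ y, p y * Real.exp (z * h y - z ^ 2 / 2) ≤ 1 := by
    intro z
    have : ∑ y, p y * Real.exp (z * h y - z ^ 2 / 2) =
        (∑ y, p y * Real.exp (z * h y)) * Real.exp (-(z ^ 2 / 2)) := by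
      rw [Finset.sum_mul]
      refine Finset.sum_congr rfl fun y _ => ?_
      rw [sub_eq_add_neg, Real.exp_add, mul_assoc]
    rw [this, Real.exp_neg]
    exact mul_inv_le_one_of_le₀ (hsub z) (Real.exp_nonneg _)
  -- For `w = 0` the mixing law degenerates to the point mass at `a`.
  rcases hw.eq_or_lt with rfl | hw
  · simp only [add_zero, Real.sqrt_one]
    convert hsub' a using 5
    ring
  -- Half the total precision `1 + 1 / w` after completing the square in `z`; the new centre depends
  -- on `y`, but the integral does not.
  set b := (1 + w) / (2 * w) with hb
  have hbpos : 0 < b := by positivity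
  set D : ι → ℝ := fun y => (2 * a * h y + w * h y ^ 2 - a ^ 2) / (2 * (1 + w))
  have hsquare : ∀ y z, Real.exp (z * h y - z ^ 2 / 2) * Real.exp (-(1 / (2 * w)) * (z - a) ^ 2) =
      Real.exp (D y) * Real.exp (-b * (z - (w * h y + a) / (1 + w)) ^ 2) := by
    intro y z
    rw [← Real.exp_add, ← Real.exp_add]
    congr 1
    simp only [D, hb]
    field_simp
    ring
  have hmono : ∫ z : ℝ, ∑ y, p y * (Real.exp (D y) *
      Real.exp (-b * (z - (w * h y + a) / (1 + w)) ^ 2)) ≤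
      ∫ z : ℝ, Real.exp (-(1 / (2 * w)) * (z - a) ^ 2) := by
    refine integral_mono (integrable_finsetSum _ fun y _ =>
      ((integrable_exp_neg_mul_sub_sq hbpos _).const_mul _).const_mul _)
      (integrable_exp_neg_mul_sub_sq (by positivity) a) fun z => ?_
    simp only [← hsquare, ← mul_assoc]
    rw [← Finset.sum_mul]
    exact mul_le_of_le_one_left (Real.exp_nonneg _) (hsub' z)
  rw [integral_finsetSum _ fun y _ =>
    ((integrable_exp_neg_mul_sub_sq hbpos _).const_mul _).const_mul _] at hmono
  simp only [integral_const_mul, integral_exp_neg_mul_sub_sq, ← mul_assoc] at hmono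
  rw [← Finset.sum_mul] at hmono
  have hsqrt : √(Real.pi / (1 / (2 * w))) = √(1 + w) * √(Real.pi / b) := by
    rw [← Real.sqrt_mul (by positivity)]
    congr 1
    rw [hb]
    field_simp
  rw [hsqrt] at hmono
  exact le_of_mul_le_mul_right hmono (Real.sqrt_pos.mpr (by positivity))

/-- Hoeffding's lemma for a finitely supported distribution on `[-1, 1]`. -/
theorem sum_mul_exp_le_of_abs_le_one {ι : Type*} [Fintype ι] {p h : ι → ℝ} (hp : ∀ y, 0 ≤ p y)
    (hp1 : ∑ y, p y = 1) (hmean : ∑ y, p y * h y = 0) (hh : ∀ y, |h y| ≤ 1) (z : ℝ) :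
    ∑ y, p y * Real.exp (z * h y) ≤ Real.exp (z ^ 2 / 2) := by
  -- Convexity: on `[-1, 1]` the graph of `u ↦ exp (z u)` lies below its chord, which is affine in
  -- `u`, so only the mean of `h` matters.
  have hconv : ∀ y, Real.exp (z * h y) ≤ Real.cosh z + h y * Real.sinh z := by
    intro y
    obtain ⟨h1, h2⟩ := abs_le.mp (hh y)
    have := convexOn_exp.2 (Set.mem_univ z) (Set.mem_univ (-z))
      (show 0 ≤ (1 + h y) / 2 by linarith) (show 0 ≤ (1 - h y) / 2 by linarith) (by ring)
    simp only [smul_eq_mul] at this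
    rw [Real.cosh_eq, Real.sinh_eq]
    calc Real.exp (z * h y) = Real.exp ((1 + h y) / 2 * z + (1 - h y) / 2 * -z) := by
          congr 1; ring
      _ ≤ _ := this
      _ = _ := by ring
  calc ∑ y, p y * Real.exp (z * h y) ≤ ∑ y, p y * (Real.cosh z + h y * Real.sinh z) :=
        Finset.sum_le_sum fun y _ => mul_le_mul_of_nonneg_left (hconv y) (hp y)
    _ = (∑ y, p y) * Real.cosh z + (∑ y, p y * h y) * Real.sinh z := by
        rw [Finset.sum_mul, Finset.sum_mul, ← Finset.sum_add_distrib]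
        exact Finset.sum_congr rfl fun y _ => by ring
    _ ≤ _ := by simpa [hp1, hmean] using Real.cosh_le_exp_half_sq z

/-- The value `(lam^M / det A)^{1/2} exp (⟨b, A⁻¹ b⟩ / 2)` of the Gaussian mixture
`∫ exp (⟨x, b⟩ - ⟨x, (A - lam I) x⟩ / 2) dN(0, lam⁻¹ I)(x)`. -/
noncomputable def mixtureValue {M : ℕ} (lam : ℝ) (A : Matrix (Fin M) (Fin M) ℝ)
    (b : Fin M → ℝ) : ℝ :=
  √(lam ^ M / A.det) * Real.exp ((b ⬝ᵥ A⁻¹ *ᵥ b) / 2)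

variable {M : ℕ}

theorem mixtureValue_nonneg (lam : ℝ) (A : Matrix (Fin M) (Fin M) ℝ) (b : Fin M → ℝ) :
    0 ≤ mixtureValue lam A b :=
  mul_nonneg (Real.sqrt_nonneg _) (Real.exp_nonneg _)

theorem mixtureValue_smul_one {lam : ℝ} (hlam : 0 < lam) :
    mixtureValue lam (lam • (1 : Matrix (Fin M) (Fin M) ℝ)) 0 = 1 := by
  simp [mixtureValue, hlam.ne']

/-- Under the Gaussian `N(A⁻¹ b, A⁻¹)` the scalar `⟨φ, x⟩` has mean `⟨φ, A⁻¹ b⟩` and variance `⟨φ,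
A⁻¹ φ⟩`. These are the `a` and `w` of `sum_mul_exp_quadratic_le_sqrt`, so this factorization
isolates a one-dimensional problem. -/
theorem mixtureValue_add_vecMulVec_self {A : Matrix (Fin M) (Fin M) ℝ} (hA : A.PosDef)
    {lam : ℝ} (hlam : 0 < lam) (φ b : Fin M → ℝ) (ε : ℝ) :
    mixtureValue lam (A + Matrix.vecMulVec φ φ) (b + ε • φ) =
      mixtureValue lam A b / √(1 + φ ⬝ᵥ A⁻¹ *ᵥ φ) *
        Real.exp ((2 * (φ ⬝ᵥ A⁻¹ *ᵥ b) * ε + (φ ⬝ᵥ A⁻¹ *ᵥ φ) * ε ^ 2 - (φ ⬝ᵥ A⁻¹ *ᵥ b) ^ 2) /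
          (2 * (1 + φ ⬝ᵥ A⁻¹ *ᵥ φ))) := by
  have hdet := hA.det_pos
  have hw : 0 ≤ φ ⬝ᵥ A⁻¹ *ᵥ φ := hA.inv.dotProduct_mulVec_self_nonneg φ
  rw [mixtureValue, mixtureValue, hA.det_add_vecMulVec_self,
    hA.inv_add_vecMulVec_self_quadratic, add_div, Real.exp_add, ← div_div,
    Real.sqrt_div (by positivity), div_div _ _ (2 : ℝ), mul_comm _ (2 : ℝ)]
  ring

/-- One step of the supermartingale property of the Gaussian mixture. -/
theorem sum_mul_mixtureValue_le {ι : Type*} [Fintype ι] (p h : ι → ℝ)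
    (hsub : ∀ z : ℝ, ∑ y, p y * Real.exp (z * h y) ≤ Real.exp (z ^ 2 / 2))
    {A : Matrix (Fin M) (Fin M) ℝ} (hA : A.PosDef) {lam : ℝ} (hlam : 0 < lam)
    (φ b : Fin M → ℝ) :
    ∑ y, p y * mixtureValue lam (A + Matrix.vecMulVec φ φ) (b + h y • φ) ≤
      mixtureValue lam A b := by
  have hw : 0 ≤ φ ⬝ᵥ A⁻¹ *ᵥ φ := hA.inv.dotProduct_mulVec_self_nonneg φ
  have hs : 0 < √(1 + φ ⬝ᵥ A⁻¹ *ᵥ φ) := Real.sqrt_pos.mpr (by linarith)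
  simp only [mixtureValue_add_vecMulVec_self hA hlam, mul_left_comm (p _)]
  rw [← Finset.mul_sum]
  calc _ ≤ mixtureValue lam A b / √(1 + φ ⬝ᵥ A⁻¹ *ᵥ φ) * √(1 + φ ⬝ᵥ A⁻¹ *ᵥ φ) :=
        mul_le_mul_of_nonneg_left (sum_mul_exp_quadratic_le_sqrt p h hsub _ hw)
          (div_nonneg (mixtureValue_nonneg _ _ _) hs.le)
    _ = _ := div_mul_cancel₀ _ hs.ne'

theorem dotProduct_inv_mulVec_le_of_mixtureValue_le {A : Matrix (Fin M) (Fin M) ℝ}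
    (hA : A.PosDef) {lam δ : ℝ} (hlam : 0 < lam) (hδ : 0 < δ) {b : Fin M → ℝ}
    (h : mixtureValue lam A b ≤ 1 / δ) :
    b ⬝ᵥ A⁻¹ *ᵥ b ≤ 2 * Real.log (√A.det / (δ * lam ^ ((M : ℝ) / 2))) := by
  have hdet := hA.det_pos
  have hpow : √(lam ^ M) = lam ^ ((M : ℝ) / 2) := by
    rw [Real.sqrt_eq_rpow, ← Real.rpow_natCast, ← Real.rpow_mul hlam.le]
    congr 1
    ring
  have hl : 0 < lam ^ ((M : ℝ) / 2) := Real.rpow_pos_of_pos hlam _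
  have hs : 0 < √A.det := Real.sqrt_pos.mpr hdet
  rw [mixtureValue, Real.sqrt_div (by positivity), hpow] at h
  have : Real.exp ((b ⬝ᵥ A⁻¹ *ᵥ b) / 2) ≤ √A.det / (δ * lam ^ ((M : ℝ) / 2)) := by
    rw [le_div_iff₀ (by positivity)]
    rw [div_mul_eq_mul_div, div_le_div_iff₀ hs hδ] at h
    linarith
  have := (Real.le_log_iff_exp_le (by positivity)).mpr this
  linarith

end GaussianMixture

/-! ### Measurability and integrability of finitely valued functions. -/

section FiniteRange

/-- `f` takes finitely many values, each of them on an `m`-measurable set. -/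
def FiniteRangeMeasurable {Ω β : Type*} (m : MeasurableSpace Ω) (f : Ω → β) : Prop :=
  (Set.range f).Finite ∧ ∀ x, MeasurableSet[m] (f ⁻¹' {x})

namespace FiniteRangeMeasurable

variable {Ω β γ : Type*} {m m' : MeasurableSpace Ω}

theorem mono (hm : m ≤ m') {f : Ω → β} (hf : FiniteRangeMeasurable m f) :
    FiniteRangeMeasurable m' f :=
  ⟨hf.1, fun x => hm _ (hf.2 x)⟩

theorem measurableSet_preimage {f : Ω → β} (hf : FiniteRangeMeasurable m f) (s : Set β) :
    MeasurableSet[m] (f ⁻¹' s) := by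
  have : f ⁻¹' s = ⋃ x ∈ s ∩ Set.range f, f ⁻¹' {x} := by
    ext ω
    simp
  rw [this]
  exact MeasurableSet.biUnion (hf.1.inter_of_right s).countable fun x _ => hf.2 x

protected theorem measurable [MeasurableSpace β] {f : Ω → β} (hf : FiniteRangeMeasurable m f) :
    Measurable[m] f :=
  fun s _ => hf.measurableSet_preimage s

theorem const (x : β) : FiniteRangeMeasurable m fun _ : Ω => x :=
  ⟨(Set.finite_singleton x).subset (by rintro _ ⟨_, rfl⟩; rfl), fun y => by
    by_cases h : x = y <;> simp [h]⟩

/-- No regularity of `g` is needed. This admits an arbitrary `σ`, as well as matrix inverses and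
determinants. -/
theorem comp {f : Ω → β} (hf : FiniteRangeMeasurable m f) (g : β → γ) :
    FiniteRangeMeasurable m fun ω => g (f ω) :=
  ⟨by simpa [Set.range_comp'] using hf.1.image g,
    fun x => hf.measurableSet_preimage (g ⁻¹' {x})⟩

theorem prodMk {f : Ω → β} {g : Ω → γ} (hf : FiniteRangeMeasurable m f)
    (hg : FiniteRangeMeasurable m g) : FiniteRangeMeasurable m fun ω => (f ω, g ω) := by
  refine ⟨(hf.1.prod hg.1).subset ?_, fun x => ?_⟩
  · rintro _ ⟨ω, rfl⟩
    exact ⟨⟨ω, rfl⟩, ⟨ω, rfl⟩⟩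
  · have : (fun ω => (f ω, g ω)) ⁻¹' {x} = f ⁻¹' {x.1} ∩ g ⁻¹' {x.2} := by
      ext ω
      simp [Prod.ext_iff]
    rw [this]
    exact (hf.2 _).inter (hg.2 _)

theorem comp₂ {δ : Type*} {f : Ω → β} {g : Ω → γ} (hf : FiniteRangeMeasurable m f)
    (hg : FiniteRangeMeasurable m g) (F : β → γ → δ) :
    FiniteRangeMeasurable m fun ω => F (f ω) (g ω) :=
  (hf.prodMk hg).comp fun x => F x.1 x.2

theorem of_measurable [MeasurableSpace β] [MeasurableSingletonClass β] {f : Ω → β}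
    (hf : Measurable[m] f) {s : Set β} (hs : s.Finite) (hfs : ∀ ω, f ω ∈ s) :
    FiniteRangeMeasurable m f :=
  ⟨hs.subset (by rintro _ ⟨ω, rfl⟩; exact hfs ω), fun x => hf (measurableSet_singleton x)⟩

theorem eval {ι : Type*} [Finite ι] {Y : Ω → ι} {g : ι → Ω → β}
    (hY : ∀ y, MeasurableSet[m] (Y ⁻¹' {y})) (hg : ∀ y, FiniteRangeMeasurable m (g y)) :
    FiniteRangeMeasurable m fun ω => g (Y ω) ω := by
  refine ⟨(Set.finite_iUnion fun y => (hg y).1).subset ?_, fun x => ?_⟩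
  · rintro _ ⟨ω, rfl⟩
    exact Set.mem_iUnion.mpr ⟨Y ω, ω, rfl⟩
  · have : (fun ω => g (Y ω) ω) ⁻¹' {x} = ⋃ y, Y ⁻¹' {y} ∩ g y ⁻¹' {x} := by
      ext ω
      simp
    rw [this]
    exact MeasurableSet.iUnion fun y => (hY y).inter ((hg y).2 x)

theorem integrable {μ : Measure[m'] Ω} [IsFiniteMeasure μ] {f : Ω → ℝ} (hm : m ≤ m')
    (hf : FiniteRangeMeasurable m f) : Integrable f μ := by
  obtain ⟨C, hC⟩ := (hf.1.image norm).bddAbove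
  exact Integrable.of_bound (hf.mono hm).measurable.aestronglyMeasurable C
    (Filter.Eventually.of_forall fun ω => hC ⟨f ω, ⟨ω, rfl⟩, rfl⟩)

end FiniteRangeMeasurable

end FiniteRange

/-! ### Conditional averaging and Ville's inequality. -/

section Supermartingale

variable {Ω : Type*} {mΩ : MeasurableSpace Ω} {μ : Measure Ω}

/-- Averaging a function of a draw `Y` from a finite set against its conditional law. -/
theorem setIntegral_comp_le_of_condExp_indicator [IsFiniteMeasure μ] {m : MeasurableSpace Ω}
    (hm : m ≤ mΩ) {ι : Type*} [Fintype ι] {Y : Ω → ι} {p : ι → Ω → ℝ}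
    (hY : ∀ y, MeasurableSet[mΩ] (Y ⁻¹' {y}))
    (hp : ∀ y, μ[(Y ⁻¹' {y}).indicator (fun _ => (1 : ℝ)) | m] =ᵐ[μ] p y)
    {g : ι → Ω → ℝ} (hg : ∀ y, FiniteRangeMeasurable m (g y)) {f : Ω → ℝ}
    (hf : FiniteRangeMeasurable m f) (hle : ∀ ω, ∑ y, p y ω * g y ω ≤ f ω)
    {s : Set Ω} (hs : MeasurableSet[m] s) :
    ∫ ω in s, g (Y ω) ω ∂μ ≤ ∫ ω in s, f ω ∂μ := by
  classical
  have hind : ∀ y, Integrable ((Y ⁻¹' {y}).indicator (fun _ => (1 : ℝ))) μ := fun y =>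
    (integrable_const (1 : ℝ)).indicator (hY y)
  have hmul : ∀ y, Integrable (g y * (Y ⁻¹' {y}).indicator (fun _ => (1 : ℝ))) μ := fun y => by
    have : g y * (Y ⁻¹' {y}).indicator (fun _ => (1 : ℝ)) = (Y ⁻¹' {y}).indicator (g y) := by
      ext ω
      by_cases h : Y ω = y <;> simp [Set.indicator, h]
    rw [this]
    exact ((hg y).integrable hm).indicator (hY y)
  have hdecomp : ∀ ω, g (Y ω) ω =
      ∑ y, (g y * (Y ⁻¹' {y}).indicator (fun _ => (1 : ℝ))) ω := by
    intro ω
    simp [Set.indicator, Finset.sum_ite_eq]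
  have hpull : ∀ y, μ[g y * (Y ⁻¹' {y}).indicator (fun _ => (1 : ℝ)) | m] =ᵐ[μ]
      fun ω => p y ω * g y ω := by
    intro y
    filter_upwards [condExp_mul_of_stronglyMeasurable_left (hg y).measurable.stronglyMeasurable
      (hmul y) (hind y), hp y] with ω h1 h2
    rw [h1, Pi.mul_apply, h2, mul_comm]
  have hint : ∀ y, Integrable (fun ω => p y ω * g y ω) μ := fun y =>
    (integrable_congr (hpull y)).mp integrable_condExp
  calc ∫ ω in s, g (Y ω) ω ∂μ
      = ∑ y, ∫ ω in s, (g y * (Y ⁻¹' {y}).indicator (fun _ => (1 : ℝ))) ω ∂μ := by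
        simp_rw [hdecomp]
        exact integral_finsetSum _ fun y _ => (hmul y).integrableOn
    _ = ∑ y, ∫ ω in s, p y ω * g y ω ∂μ := by
        refine Finset.sum_congr rfl fun y _ => ?_
        rw [← setIntegral_condExp hm (hmul y) hs]
        exact integral_congr_ae (ae_restrict_of_ae (hpull y))
    _ = ∫ ω in s, ∑ y, p y ω * g y ω ∂μ :=
        (integral_finsetSum _ fun y _ => (hint y).integrableOn).symm
    _ ≤ ∫ ω in s, f ω ∂μ :=
        integral_mono (integrable_finsetSum _ fun y _ => (hint y).integrableOn)
          (hf.integrable hm).integrableOn hle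

/-- Ville's inequality for a nonnegative supermartingale started at `1`. -/
theorem measureReal_exists_lt_le_of_supermartingale [IsProbabilityMeasure μ]
    {ℱ : Filtration ℕ mΩ} {f : ℕ → Ω → ℝ} (hf : Supermartingale f ℱ μ) (hnn : ∀ t ω, 0 ≤ f t ω)
    (h0 : ∀ ω, f 0 ω = 1) {δ : ℝ} (hδ : 0 < δ) :
    μ.real {ω | ∃ t, 1 / δ < f t ω} ≤ δ := by
  rcases le_or_gt 1 δ with hδ1 | hδ1
  · exact measureReal_le_one.trans hδ1
  set A : ℕ → Set Ω := fun n => {ω | ∀ t ≤ n, f t ω ≤ 1 / δ} with hA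
  have hfm : ∀ t, StronglyMeasurable[ℱ t] (f t) := hf.stronglyAdapted
  have hAm : ∀ n, MeasurableSet[ℱ n] (A n) := by
    intro n
    have : A n = ⋂ t ∈ Set.Iic n, f t ⁻¹' Set.Iic (1 / δ) := by
      ext ω
      simp [hA]
    rw [this]
    exact MeasurableSet.biInter (Set.to_countable _) fun t ht =>
      ℱ.mono ht _ ((hfm t).measurable measurableSet_Iic)
  have hAm' : ∀ n, MeasurableSet (A n) := fun n => ℱ.le n _ (hAm n)
  have hanti : ∀ n, A (n + 1) ⊆ A n := fun n ω hω t ht => hω t (by omega)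
  -- Optional stopping by induction: the paths that first exceed `1 / δ` at time `n + 1` leave the
  -- integral and contribute at least `1 / δ` times their probability.
  have key : ∀ n, 1 / δ * μ.real (A n)ᶜ + ∫ ω in A n, f n ω ∂μ ≤ 1 := by
    intro n
    induction n with
    | zero =>
      have : A 0 = Set.univ := by
        ext ω
        simpa [hA, h0] using (one_le_inv₀ hδ).mpr hδ1.le
      simp [this, h0]
    | succ n ih =>
      have h1 : ∫ ω in A n, f (n + 1) ω ∂μ ≤ ∫ ω in A n, f n ω ∂μ :=
        hf.setIntegral_le n.le_succ (hAm n)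
      have hint : Integrable (f (n + 1)) μ := hf.integrable (n + 1)
      have h2 : ∫ ω in A n, f (n + 1) ω ∂μ =
          ∫ ω in A (n + 1), f (n + 1) ω ∂μ + ∫ ω in A n \ A (n + 1), f (n + 1) ω ∂μ := by
        rw [← setIntegral_union Set.disjoint_sdiff_right ((hAm' n).diff (hAm' (n + 1)))
          hint.integrableOn hint.integrableOn, Set.union_sdiff_cancel (hanti n)]
      have h3 : 1 / δ * μ.real (A n \ A (n + 1)) ≤ ∫ ω in A n \ A (n + 1), f (n + 1) ω ∂μ := by
        refine setIntegral_ge_of_const_le_real ((hAm' n).diff (hAm' (n + 1)))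
          (measure_ne_top _ _) (fun ω hω => ?_) hint.integrableOn
        by_contra hlt
        refine hω.2 fun t ht => ?_
        rcases Nat.le_succ_iff.mp ht with h | rfl
        · exact hω.1 t h
        · exact (not_le.mp hlt).le
      have h4 : μ.real (A (n + 1))ᶜ = μ.real (A n)ᶜ + μ.real (A n \ A (n + 1)) := by
        rw [← measureReal_union (disjoint_compl_left.mono_right Set.sdiff_subset)
          ((hAm' n).diff (hAm' (n + 1)))]
        congr 1
        ext ω
        have := @hanti n ω
        simp only [Set.mem_compl_iff, Set.mem_union, Set.mem_sdiff]
        tauto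
      rw [h4, mul_add]
      linarith
  have hbound : ∀ n, μ.real (A n)ᶜ ≤ δ := by
    intro n
    have h5 : 0 ≤ ∫ ω in A n, f n ω ∂μ := integral_nonneg (hnn n)
    have h6 : 1 / δ * μ.real (A n)ᶜ ≤ 1 := by linarith [key n]
    rwa [one_div_mul_eq_div, div_le_one hδ] at h6
  have hunion : {ω | ∃ t, 1 / δ < f t ω} = ⋃ n, (A n)ᶜ := by
    ext ω
    simp only [hA, Set.mem_ofPred_eq, Set.mem_iUnion, Set.mem_compl_iff, not_forall, not_le]
    exact ⟨fun ⟨t, ht⟩ => ⟨t, t, le_rfl, ht⟩, fun ⟨_, t, _, ht⟩ => ⟨t, ht⟩⟩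
  have hmono : Monotone fun n => (A n)ᶜ :=
    monotone_nat_of_le_succ fun n => Set.compl_subset_compl.mpr (hanti n)
  rw [hunion]
  refine le_of_tendsto ((ENNReal.tendsto_toReal (measure_ne_top _ _)).comp
    (tendsto_measure_iUnion_atTop hmono)) (Filter.Eventually.of_forall hbound)

end Supermartingale

/-! ### The mixture along the path as a supermartingale. -/

section SelfNormalized

/-- The self-normalized large deviation bound for the noise `h t (Y (t + 1))`, conditionally
`1`-subgaussian given `ℱ t`, in the form of a maximal inequality for the Gaussian mixture. -/
theorem measureReal_exists_lt_mixtureValue_le {Ω : Type*} {mΩ : MeasurableSpace Ω}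
    {μ : Measure Ω} [IsProbabilityMeasure μ] {ℱ : Filtration ℕ mΩ} {M : ℕ} {ι : Type*}
    [Fintype ι] {φ : ℕ → Ω → Fin M → ℝ} {Y : ℕ → Ω → ι} {p h : ℕ → ι → Ω → ℝ}
    (hφ : ∀ t, FiniteRangeMeasurable (ℱ t) (φ t))
    (hY : ∀ t y, MeasurableSet[ℱ (t + 1)] (Y (t + 1) ⁻¹' {y}))
    (hp : ∀ t y, μ[(Y (t + 1) ⁻¹' {y}).indicator (fun _ => (1 : ℝ)) | ℱ t] =ᵐ[μ] p t y)
    (hh : ∀ t y, FiniteRangeMeasurable (ℱ t) (h t y))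
    (hsub : ∀ t ω z, ∑ y, p t y ω * Real.exp (z * h t y ω) ≤ Real.exp (z ^ 2 / 2))
    {lam δ : ℝ} (hlam : 0 < lam) (hδ : 0 < δ) :
    μ.real {ω | ∃ T, 1 / δ < mixtureValue lam (regGram lam (fun t => φ t ω) T)
      (∑ t ∈ Finset.range T, h t (Y (t + 1) ω) ω • φ t ω)} ≤ δ := by
  have hA : ∀ T, FiniteRangeMeasurable (ℱ T) fun ω => regGram lam (fun t => φ t ω) T := by
    intro T
    induction T with
    | zero => simpa only [regGram_zero] using FiniteRangeMeasurable.const _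
    | succ T ih =>
      simp only [regGram_succ]
      exact (ih.comp₂ (hφ T) fun A v => A + Matrix.vecMulVec v v).mono (ℱ.mono T.le_succ)
  have hS : ∀ T, FiniteRangeMeasurable (ℱ T)
      fun ω => ∑ t ∈ Finset.range T, h t (Y (t + 1) ω) ω • φ t ω := by
    intro T
    induction T with
    | zero => simpa only [Finset.sum_range_zero] using FiniteRangeMeasurable.const _
    | succ T ih =>
      simp only [Finset.sum_range_succ]
      have hle := ℱ.mono T.le_succ
      exact (ih.mono hle).comp₂ ((FiniteRangeMeasurable.eval (hY T)
        fun y => (hh T y).mono hle).comp₂ ((hφ T).mono hle) fun c v => c • v) fun a b => a + b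
  have hV : ∀ T, FiniteRangeMeasurable (ℱ T) fun ω => mixtureValue lam
      (regGram lam (fun t => φ t ω) T)
      (∑ t ∈ Finset.range T, h t (Y (t + 1) ω) ω • φ t ω) :=
    fun T => (hA T).comp₂ (hS T) (mixtureValue lam)
  refine measureReal_exists_lt_le_of_supermartingale (ℱ := ℱ)
    (supermartingale_of_setIntegral_succ_le (fun T => (hV T).measurable.stronglyMeasurable)
      (fun T => (hV T).integrable (ℱ.le T)) fun T s hs => ?_)
    (fun _ _ => mixtureValue_nonneg _ _ _)
    (fun ω => by simpa [regGram_zero] using mixtureValue_smul_one hlam) hδ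
  simp only [regGram_succ, Finset.sum_range_succ]
  exact setIntegral_comp_le_of_condExp_indicator (ℱ.le T) (fun y => ℱ.le _ _ (hY T y)) (hp T)
    (g := fun y ω => mixtureValue lam
      (regGram lam (fun t => φ t ω) T + Matrix.vecMulVec (φ T ω) (φ T ω))
      (∑ t ∈ Finset.range T, h t (Y (t + 1) ω) ω • φ t ω + h T y ω • φ T ω))
    (fun y => ((hA T).comp₂ (hφ T) fun A v => A + Matrix.vecMulVec v v).comp₂
      ((hS T).comp₂ ((hh T y).comp₂ (hφ T) fun c v => c • v) fun a b => a + b) (mixtureValue lam))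
    (hV T) (fun ω => sum_mul_mixtureValue_le (fun y => p T y ω) (fun y => h T y ω) (hsub T ω)
      (regGram_posDef hlam _ T) hlam _ _) hs

end SelfNormalized

/-! ### Centering and boundedness of the mini-batch noise. -/

section MiniBatch

theorem sum_prod_stdSimplex_eq_one {X : Type*} [Fintype X] {N : ℕ} (p : stdSimplex ℝ X) :
    ∑ y : Fin N → X, ∏ m, p.1 (y m) = 1 := by
  have := Finset.prod_univ_sum (fun _ : Fin N => (Finset.univ : Finset X)) fun _ x => p.1 x
  rw [Fintype.piFinset_univ] at this
  rw [← this, p.2.2, Finset.prod_const_one]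

/-- The centered and normalized sampling noise of the mini-batch transition risk is
`1`-subgaussian under the joint law of the batch and the selected index. -/
theorem sum_mul_exp_miniBatch_noise_le {X : Type*} [Fintype X] [DecidableEq X] {N : ℕ} [NeZero N]
    (σ : X → stdSimplex ℝ X → (X → ℝ) → ℝ) (i : X)
    (p : stdSimplex ℝ X) (v : X → ℝ) {R : ℝ} (hR : 0 < R)
    (hbound : ∀ y : Fin N → X, |σ i (empiricalMeasure y) v - miniBatchRisk N σ i p v| ≤ R)
    (z : ℝ) :
    ∑ a : (Fin N → X) × Fin N, ((∏ m, p.1 (a.1 m)) * (1 / (N : ℝ))) *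
      Real.exp (z * ((σ i (empiricalMeasure a.1) v - miniBatchRisk N σ i p v) / R)) ≤
      Real.exp (z ^ 2 / 2) := by
  have hN : (N : ℝ) ≠ 0 := by exact_mod_cast NeZero.ne N
  have hsum : ∀ f : (Fin N → X) → ℝ,
      ∑ a : (Fin N → X) × Fin N, ((∏ m, p.1 (a.1 m)) * (1 / (N : ℝ))) * f a.1 =
        ∑ y, (∏ m, p.1 (y m)) * f y := by
    intro f
    rw [Fintype.sum_prod_type]
    refine Finset.sum_congr rfl fun y _ => ?_
    simp only [Finset.sum_const, Finset.card_univ, Fintype.card_fin, nsmul_eq_mul]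
    field_simp
  rw [hsum fun y => Real.exp (z * ((σ i (empiricalMeasure y) v - miniBatchRisk N σ i p v) / R))]
  refine sum_mul_exp_le_of_abs_le_one (fun y => Finset.prod_nonneg fun m _ => p.2.1 (y m))
    (sum_prod_stdSimplex_eq_one p) ?_ (fun y => ?_) z
  · simp only [← mul_div_assoc]
    rw [← Finset.sum_div]
    simp only [mul_sub, Finset.sum_sub_distrib]
    rw [← Finset.sum_mul, sum_prod_stdSimplex_eq_one, one_mul]
    simp [miniBatchRisk]
  · rw [abs_div, abs_of_pos hR, div_le_one hR]
    exact hbound y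

end MiniBatch

/-! ### Assembly of the bound. -/

theorem exists_isRegSolution_weight {lam ρ : ℝ} (hlam : 0 < lam) {T : ℕ} (hT : 1 ≤ T)
    (hρ : ρ = lam / T ∨ ρ = lam) : ∃ κ, lam ≤ κ ∧ ρ = κ / T := by
  rcases hρ with rfl | rfl
  · exact ⟨lam, le_rfl, rfl⟩
  · have hT' : (1 : ℝ) ≤ T := by exact_mod_cast hT
    exact ⟨ρ * T, le_mul_of_one_le_right hlam.le hT', by field_simp⟩

theorem theoremt {X : Type*} [Fintype X] [DecidableEq X] [MeasurableSpace X]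
    [MeasurableSingletonClass X] {M N : ℕ} [NeZero N]
    (P : X → stdSimplex ℝ X) (σ : X → stdSimplex ℝ X → (X → ℝ) → ℝ)
    (Φ : Matrix X (Fin M) ℝ) (Θ : Finset (Fin M → ℝ)) :
    ∃ R : ℝ, 0 < R ∧
      ∀ (c : X → ℝ) (α lam : ℝ) (P₀ : stdSimplex ℝ X), 0 < α → α < 1 → 0 < lam →
      ∀ (Ω : Type*) (mΩ : MeasurableSpace Ω) (μ : Measure Ω) (ℱ : Filtration ℕ mΩ)
        (s : ℕ → Ω → X) (j : ℕ → Ω → Fin N → X) (k : ℕ → Ω → Fin N) (θprev : Ω → Fin M → ℝ),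
      IsProbabilityMeasure μ →
      IsEpisode P₀ P μ ℱ s j k →
      Measurable[ℱ 0] θprev → (∀ ω, θprev ω ∈ Θ) →
      -- the explicit formulas give the unique solutions of the two least-squares problems;
      -- the regularization weight is `κ / T`
      (∀ (ω : Ω) (T : ℕ) (κ : ℝ), 1 ≤ T → 0 < κ →
        (∀ θ, IsRegSolution (κ / T) (featurePath Φ s ω) (sampleTarget σ c α s j (Φ *ᵥ θprev ω) ω) T θ ↔
          θ = (regGram κ (featurePath Φ s ω) T)⁻¹ *ᵥ
            ∑ t ∈ Finset.range T, sampleTarget σ c α s j (Φ *ᵥ θprev ω) ω t • featurePath Φ s ω t) ∧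
        (∀ θ, IsRegSolution (κ / T) (featurePath Φ s ω) (idealTarget N σ P c α s (Φ *ᵥ θprev ω) ω) T θ ↔
          θ = (regGram κ (featurePath Φ s ω) T)⁻¹ *ᵥ
            ∑ t ∈ Finset.range T, idealTarget N σ P c α s (Φ *ᵥ θprev ω) ω t • featurePath Φ s ω t)) ∧
      -- the large deviation bound, uniform in time, with the weight normalized either way
      ∀ δ : ℝ, 0 < δ →
        1 - δ ≤ μ.real {ω | ∀ T : ℕ, 1 ≤ T → ∀ ρ : ℝ, ρ = lam / T ∨ ρ = lam →
          ∀ θtilde θhat : Fin M → ℝ,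
            IsRegSolution ρ (featurePath Φ s ω) (sampleTarget σ c α s j (Φ *ᵥ θprev ω) ω) T θtilde →
            IsRegSolution ρ (featurePath Φ s ω) (idealTarget N σ P c α s (Φ *ᵥ θprev ω) ω) T θhat →
            (θtilde - θhat) ⬝ᵥ (regGram lam (featurePath Φ s ω) T *ᵥ (θtilde - θhat)) ≤
              2 * α ^ 2 * R ^ 2 *
                Real.log (Real.sqrt (regGram lam (featurePath Φ s ω) T).det /
                  (δ * lam ^ ((M : ℝ) / 2)))} := by

  set D : (Fin M → ℝ) → X → (Fin N → X) → ℝ := fun θ x y =>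
    σ x (empiricalMeasure y) (Φ *ᵥ θ) - miniBatchRisk N σ x (P x) (Φ *ᵥ θ) with hD
  -- The sum dominates each noise value; the `1` makes `R` positive. Neither `c`, `α`, `lam` nor the
  -- episode enters.
  set R : ℝ := 1 + ∑ θ ∈ Θ, ∑ x, ∑ y, |D θ x y| with hR
  have hDR : ∀ θ ∈ Θ, ∀ x y, |D θ x y| ≤ R := by
    intro θ hθ x y
    have h1 : |D θ x y| ≤ ∑ y, |D θ x y| :=
      Finset.single_le_sum (f := fun y => |D θ x y|) (fun _ _ => abs_nonneg _) (Finset.mem_univ y)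
    have h2 : ∑ y, |D θ x y| ≤ ∑ x, ∑ y, |D θ x y| :=
      Finset.single_le_sum (f := fun x => ∑ y, |D θ x y|)
        (fun _ _ => Finset.sum_nonneg fun _ _ => abs_nonneg _) (Finset.mem_univ x)
    have h3 : ∑ x, ∑ y, |D θ x y| ≤ ∑ θ ∈ Θ, ∑ x, ∑ y, |D θ x y| :=
      Finset.single_le_sum (f := fun θ => ∑ x, ∑ y, |D θ x y|)
        (fun _ _ => Finset.sum_nonneg fun _ _ => Finset.sum_nonneg fun _ _ => abs_nonneg _) hθ
    linarith
  have hRpos : 0 < R := by positivity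
  refine ⟨R, hRpos, ?_⟩
  intro c α lam P₀ hα hα1 hlam Ω mΩ μ ℱ s j k θprev hμ hep hθ hθΘ
  refine ⟨fun ω T κ hT hκ => ⟨isRegSolution_iff hκ hT _ _, isRegSolution_iff hκ hT _ _⟩, ?_⟩
  intro δ hδ
  have hs : ∀ t, FiniteRangeMeasurable (ℱ t) (s t) := fun t =>
    .of_measurable (hep.measurable_state t) Set.finite_univ fun _ => Set.mem_univ _
  have hθm : ∀ t, FiniteRangeMeasurable (ℱ t) θprev := fun t =>
    (FiniteRangeMeasurable.of_measurable hθ Θ.finite_toSet hθΘ).mono (ℱ.mono t.zero_le)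
  have hpre : ∀ t (a : (Fin N → X) × Fin N), (fun ω => (j (t + 1) ω, k (t + 1) ω)) ⁻¹' {a} =
      {ω | j (t + 1) ω = a.1 ∧ k (t + 1) ω = a.2} := by
    intro t a
    ext ω
    simp [Prod.ext_iff]
  -- The draw is the pair of batch and selected index, matching the joint conditional law; the noise
  -- ignores the index.
  have hbad := measureReal_exists_lt_mixtureValue_le (μ := μ) (ℱ := ℱ)
    (φ := fun t ω => featurePath Φ s ω t) (Y := fun t ω => (j t ω, k t ω))
    (p := fun t a ω => (∏ m, (P (s t ω)).1 (a.1 m)) * (1 / (N : ℝ)))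
    (h := fun t a ω => D (θprev ω) (s t ω) a.1 / R)
    (fun t => (hs t).comp Φ)
    (fun t a => by
      rw [hpre]
      exact (hep.measurable_batch t (measurableSet_singleton a.1)).inter
        (hep.measurable_index t (measurableSet_singleton a.2)))
    (fun t a => by
      rw [hpre]
      exact hep.conditional_law t a.1 a.2)
    (fun t a => (hθm t).comp₂ (hs t) fun θ x => D θ x a.1 / R)
    (fun t ω z => sum_mul_exp_miniBatch_noise_le σ (s t ω) (P (s t ω)) (Φ *ᵥ θprev ω) hRpos
      (hDR _ (hθΘ ω) (s t ω)) z)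
    hlam hδ
  set B := {ω | ∃ T, 1 / δ < mixtureValue lam (regGram lam (fun t => featurePath Φ s ω t) T)
      (∑ t ∈ Finset.range T, (D (θprev ω) (s t ω) (j (t + 1) ω) / R) • featurePath Φ s ω t)}
    with hB
  -- Subadditivity suffices here, so measurability of `B` is not needed.
  have hcompl : 1 ≤ μ.real Bᶜ + μ.real B := by
    have h1 := measureReal_union_le (μ := μ) Bᶜ B
    rwa [Set.compl_union_self, probReal_univ] at h1
  refine le_trans (by linarith) (measureReal_mono (μ := μ) (s₁ := Bᶜ) ?_)
  intro ω hω T hT ρ hρ θt θh ht hh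
  obtain ⟨κ, hκ, rfl⟩ := exists_isRegSolution_weight hlam hT hρ
  rw [isRegSolution_iff (hlam.trans_le hκ) hT] at ht hh
  set S := ∑ t ∈ Finset.range T, (D (θprev ω) (s t ω) (j (t + 1) ω) / R) • featurePath Φ s ω t
    with hS
  have hdiff : θt - θh = (regGram κ (featurePath Φ s ω) T)⁻¹ *ᵥ ((α * R) • S) := by
    rw [ht, hh, ← Matrix.mulVec_sub, ← Finset.sum_sub_distrib, hS, Finset.smul_sum]
    congr 1
    refine Finset.sum_congr rfl fun t _ => ?_
    rw [← sub_smul, smul_smul]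
    congr 1
    simp only [sampleTarget, idealTarget, hD]
    field_simp
    ring
  have hgood : mixtureValue lam (regGram lam (featurePath Φ s ω) T) S ≤ 1 / δ :=
    not_lt.mp fun h => hω ⟨T, h⟩
  have hlog := dotProduct_inv_mulVec_le_of_mixtureValue_le (regGram_posDef hlam _ T) hlam hδ hgood
  calc (θt - θh) ⬝ᵥ (regGram lam (featurePath Φ s ω) T *ᵥ (θt - θh))
      ≤ ((α * R) • S) ⬝ᵥ (regGram lam (featurePath Φ s ω) T)⁻¹ *ᵥ ((α * R) • S) := by
        rw [hdiff]
        exact dotProduct_regGram_mulVec_le hlam hκ _ T _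
    _ = (α * R) ^ 2 * (S ⬝ᵥ (regGram lam (featurePath Φ s ω) T)⁻¹ *ᵥ S) := by
        rw [Matrix.mulVec_smul, dotProduct_smul, smul_dotProduct, smul_eq_mul, smul_eq_mul]
        ring
    _ ≤ (α * R) ^ 2 * (2 * Real.log (√(regGram lam (featurePath Φ s ω) T).det /
          (δ * lam ^ ((M : ℝ) / 2)))) := mul_le_mul_of_nonneg_left hlog (sq_nonneg _)
    _ = _ := by ring
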